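/- **Theorem 4.1 (Subderivative-subdifferential duality formula).** Let $X$ be a real Banach space with topological dual $X^*$. All functions $f:X\to\,]-\infty,+\infty]$ below are assumed lower semicontinuous and proper, i.e. $\operatorname{dom} f:=\{x: f(x)<\infty\}\neq\emptyset$. For $x\in\operatorname{dom} f$ and $u\in X$ put $$f^r(x;u):=\liminf_{t\searrow 0}\frac{f(x+tu)-f(x)}{t},\qquad f^d(x;u):=\liminf_{t\searrow 0,\;u'\to u}\frac{f(x+tu')-f(x)}{t},$$ $$f^\uparrow(x;u):=\sup_{\delta>0}\ \limsup_{t\searrow 0,\;(y,f(y))\to(x,f(x))}\ \inf_{\|u'-u\|\le\delta}\frac{f(y+tu')-f(y)}{t},$$ $$\partial_{MR}f(x):=\{x^*\in X^*:\langle x^*,y-x\rangle+f(x)\le f(y)\ \ \forall y\in X\},\qquad \partial_Cf(x):=\{x^*\in X^*:\langle x^*,u\rangle\le f^\uparrow(x;u)\ \ \forall u\in X\},$$ and let $\partial_{MR}f(x)=\partial_Cf(x)=\emptyset$ for $x\notin\operatorname{dom}f$. A *subdifferential* on $X$ is an operator $\partial$ that associates to each function $f$ on $X$ a set-valued map $\partial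 f:X\rightrightarrows X^*$ such that $\partial_{MR}f(x)\subset\partial f(x)\subset\partial_Cf(x)$ for all $x$, and such that the *Separation Principle* holds: for all $f$ and all convex $\varphi$ and every $\bar z\in\operatorname{dom}f$ such that $\varphi$ is (finite and) Lipschitz near $\bar z$, if $f+\varphi$ has a local minimum at $\bar z$, then $0\in\widehat\partial f(\bar z)+\partial\varphi(\bar z)$. Here $\widehat\partial f(\bar z)$ is the set of all $\bar z^*\in X^*$ for which there is a net $(x_\nu,x^*_\nu)_\nu$ with $x^*_\nu\in\partial f(x_\nu)$, $(x_\nu,f(x_\nu))\to(\bar z,f(\bar z))$, $x^*_\nu\to\bar z^*$ weak$^*$, and $\limsup_\nu\langle x^*_\nu,x_\nu-\bar z\rangle\le 0$. Write $f^\partial(x;u):=\sup\{\langle x^*,u\rangle:x^*\in\partial f(x)\}$, with $\sup\emptyset=-\infty$. For $\bar x,v\in X$ and a function $F:\operatorname{dom} f\to[-\infty,+\infty]$ let $$\limsup_{x\to_v\bar x}F(x):=\inf_{\varepsilon>0}\ \sup\{F(x): x\in\operatorname{dom}f,\ x=\bar x+tv',\ 0<t<\varepsilon,\ \|v'-v\|<\varepsilon\}.$$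 Let $\partial$ be a subdifferential on $X$, let $f$ be a proper lower semicontinuous function as above, and let $f':\operatorname{dom}f\times X\to[-\infty,+\infty]$ be any function with $f^d\le f'\le f^\uparrow$ on $\operatorname{dom}f\times X$. Then for every $\bar x\in\operatorname{dom}f$, all $u,v\in X$ and every real $\alpha\ge 0$, $$\limsup_{x\to_v\bar x}f^r(x;u+\alpha(\bar x-x))=\limsup_{x\to_v\bar x}f'(x;u+\alpha(\bar x-x))=\limsup_{x\to_v\bar x}f^\partial(x;u+\alpha(\bar x-x)).$$ -/

import Mathlib

open Filter Topology

universe u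

noncomputable section

/-- The effective domain `dom f = {x | f x < ∞}`. -/
def effDom {X : Type u} (f : X → EReal) : Set X :=
  {x | f x < ⊤}

/-- A proper lower semicontinuous function with values in `]-∞, +∞]`. -/
structure IsProperLsc {X : Type u} [TopologicalSpace X] (f : X → EReal) : Prop where
  ne_bot : ∀ x, f x ≠ ⊥
  nonempty : (effDom f).Nonempty
  lsc : LowerSemicontinuous f

/-- The difference quotient `(f (x + t u) - f x) / t`; it is only used for `t > 0` and finite
`f x`, where the extended-real operations involve no convention. -/
def diffQuot {X : Type u} [NormedAddCommGroup X] [NormedSpace ℝ X]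
    (f : X → EReal) (x : X) (t : ℝ) (u : X) : EReal :=
  (f (x + t • u) - f x) / (t : EReal)

/-- The (lower right Dini) radial subderivative
`f^r(x; u) = liminf_{t ↘ 0} (f (x + t u) - f x) / t`. -/
def radialSubderiv {X : Type u} [NormedAddCommGroup X] [NormedSpace ℝ X]
    (f : X → EReal) (x u : X) : EReal :=
  liminf (fun t : ℝ => diffQuot f x t u) (𝓝[>] 0)

/-- The (lower right Dini-Hadamard) directional subderivative
`f^d(x; u) = liminf_{t ↘ 0, u' → u} (f (x + t u') - f x) / t`. -/
def directionalSubderiv {X : Type u} [NormedAddCommGroup X] [NormedSpace ℝ X]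
    (f : X → EReal) (x u : X) : EReal :=
  liminf (fun p : ℝ × X => diffQuot f x p.1 p.2) (𝓝[>] 0 ×ˢ 𝓝 u)

/-- The filter `(y, f y) → (x, f x)`. -/
def graphNhds {X : Type u} [TopologicalSpace X] (f : X → EReal) (x : X) : Filter X :=
  comap (fun y => (y, f y)) (𝓝 (x, f x))

/-- The Clarke-Rockafellar subderivative
`f^↑(x; u) = sup_{δ > 0} limsup_{t ↘ 0, (y, f y) → (x, f x)} inf_{u' ∈ B_δ(u)}
(f (y + t u') - f y) / t`. -/
def clarkeRockafellarSubderiv {X : Type u} [NormedAddCommGroup X] [NormedSpace ℝ X]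
    (f : X → EReal) (x u : X) : EReal :=
  ⨆ (δ : ℝ) (_ : 0 < δ),
    limsup (fun p : ℝ × X => ⨅ u' ∈ Metric.closedBall u δ, diffQuot f p.2 p.1 u')
      (𝓝[>] 0 ×ˢ graphNhds f x)

/-- The Moreau-Rockafellar subdifferential (empty outside the domain). -/
def moreauRockafellarSubdiff {X : Type u} [NormedAddCommGroup X] [NormedSpace ℝ X]
    (f : X → EReal) (x : X) : Set (X →L[ℝ] ℝ) :=
  {xs | x ∈ effDom f ∧ ∀ y, ((xs (y - x) : ℝ) : EReal) + f x ≤ f y}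

/-- The Clarke subdifferential (empty outside the domain). -/
def clarkeSubdiff {X : Type u} [NormedAddCommGroup X] [NormedSpace ℝ X]
    (f : X → EReal) (x : X) : Set (X →L[ℝ] ℝ) :=
  {xs | x ∈ effDom f ∧ ∀ u, ((xs u : ℝ) : EReal) ≤ clarkeRockafellarSubderiv f x u}

/-- The weak*-controlled closure at `x` of a set-valued map `T`, relative to `f`: all `xs` for
which there is a net `(x_ν, xs_ν)` in the graph of `T` with `(x_ν, f (x_ν)) → (x, f x)`,
`xs_ν → xs` weak* (that is, pointwise) and `limsup_ν ⟨xs_ν, x_ν - x⟩ ≤ 0`. -/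
def controlledClosure {X : Type u} [NormedAddCommGroup X] [NormedSpace ℝ X]
    (f : X → EReal) (T : X → Set (X →L[ℝ] ℝ)) (x : X) : Set (X →L[ℝ] ℝ) :=
  {xs | ∃ (ι : Type u) (_ : Preorder ι) (_ : IsDirectedOrder ι) (_ : Nonempty ι)
      (y : ι → X) (ys : ι → X →L[ℝ] ℝ),
      (∀ ν, ys ν ∈ T (y ν)) ∧
      Tendsto (fun ν => (y ν, f (y ν))) atTop (𝓝 (x, f x)) ∧
      (∀ w, Tendsto (fun ν => ys ν w) atTop (𝓝 (xs w))) ∧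
      limsup (fun ν => ((ys ν (y ν - x) : ℝ) : EReal)) atTop ≤ 0}

/-- Convexity of an extended-real function: its epigraph is convex. -/
def IsConvexFn {X : Type u} [NormedAddCommGroup X] [NormedSpace ℝ X] (φ : X → EReal) : Prop :=
  Convex ℝ {p : X × ℝ | φ p.1 ≤ (p.2 : EReal)}

/-- `φ` is finite and Lipschitz on a neighbourhood of `x`. -/
def IsLipschitzNear {X : Type u} [NormedAddCommGroup X] (φ : X → EReal) (x : X) : Prop :=
  ∃ K : NNReal, ∃ U ∈ 𝓝 x, ∃ g : X → ℝ, (∀ y ∈ U, φ y = (g y : EReal)) ∧ LipschitzOnWith K g U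

/-- The Separation Principle in `X` for an operator `D` that associates a set-valued map
`D f : X ⇉ X*` to each function `f` on `X`. -/
def SeparationPrinciple {X : Type u} [NormedAddCommGroup X] [NormedSpace ℝ X]
    (D : (X → EReal) → X → Set (X →L[ℝ] ℝ)) : Prop :=
  ∀ (f φ : X → EReal) (x : X), IsProperLsc f → IsProperLsc φ → IsConvexFn φ →
    x ∈ effDom f → IsLipschitzNear φ x → IsLocalMin (fun y => f y + φ y) x →
    ∃ xs ∈ controlledClosure f (D f) x, ∃ zs ∈ D φ x, xs + zs = 0

/-- A subdifferential on `X`: an operator `D` with `∂_MR f ⊆ D f ⊆ ∂_C f` for all proper lsc `f`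
and with the Separation Principle. -/
structure IsSubdifferential {X : Type u} [NormedAddCommGroup X] [NormedSpace ℝ X]
    (D : (X → EReal) → X → Set (X →L[ℝ] ℝ)) : Prop where
  moreauRockafellar_subset : ∀ f, IsProperLsc f → ∀ x, moreauRockafellarSubdiff f x ⊆ D f x
  subset_clarke : ∀ f, IsProperLsc f → ∀ x, D f x ⊆ clarkeSubdiff f x
  separation : SeparationPrinciple D

/-- The support function `sup {⟨xs, u⟩ | xs ∈ S}`, with value `-∞` for empty `S`. The
subderivative associated to a subdifferential `∂` is
`f^∂(x; u) = supportFn (∂ f x) u`. -/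
def supportFn {X : Type u} [NormedAddCommGroup X] [NormedSpace ℝ X]
    (S : Set (X →L[ℝ] ℝ)) (u : X) : EReal :=
  ⨆ xs ∈ S, ((xs u : ℝ) : EReal)

/-- Directional convergence `y →_v x` from the direction `v`: `y = x + t v'` with `t ↘ 0` and
`v' → v`. The drops `{x + t v' | 0 < t < ε, v' ∈ B(v, ε)}`, `ε > 0`, form a basis. -/
def dirNhds {X : Type u} [NormedAddCommGroup X] [NormedSpace ℝ X] (x v : X) : Filter X :=
  map (fun p : ℝ × X => x + p.1 • p.2) (𝓝[>] 0 ×ˢ 𝓝 v)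

/-- `limsup_{y →_v x} F y` for a function `F` that matters on `dom f` only: the infimum over
`ε > 0` of the suprema of `F` over the points of `dom f` in the drop
`{x + t v' | 0 < t < ε, v' ∈ B(v, ε)}` (with `sup ∅ = -∞`). -/
def dirLimsup {X : Type u} [NormedAddCommGroup X] [NormedSpace ℝ X]
    (f : X → EReal) (x v : X) (F : X → EReal) : EReal :=
  limsup F (dirNhds x v ⊓ 𝓟 (effDom f))

end

/-!
The drops defining `y →_v x` are open, so a bound `F(y; w) ≤ limsup_{z → y} G(z; w + α (y - z))` at
all points `y ∈ dom f` passes to the directional upper limits: with `w = u + α (x - y)` the right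
side is `G(z; u + α (x - z))`. Such bounds are found along the cycle
`f^r ≤ f^∂̂ ≤ f^∂ ≤ f^↑ ≤ f^d ≤ f^r`.

* `f^r` and `f^∂̂`: if `l < f^r(x; w)`, then `f` lies above an affine function of slope greater than
  `l` on a segment `[x, x + t w]`. A large multiple of the distance to this segment makes `x` an
  approximate local minimizer, and Ekeland's principle with the Separation Principle gives
  `z* ∈ ∂̂f(z)` at some `z` near `x`. As `α ≥ 0`, small steps from `z` along `w + α (x - z)` do not
  increase the distance to the segment, so the penalty does not affect `⟨z*, w + α (x - z)⟩`.
* `f^∂̂` and `f^∂`: along a net, `limsup ⟨x*_ν, x_ν - x⟩ ≤ 0` says that the shift by `α (x - x_ν)`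
  does not decrease the limit of `⟨x*_ν, w⟩`.
* `f^↑` and `f^d`: if `f^d(z; w + α (x - z)) < l` near `x`, then steps of slope less than `l` can be
  prolonged, by Phelps' extremization principle, to reach any small time prescribed in `f^↑`.
-/

section VariationalPrinciple

theorem isClosed_setOf_apply_le {Y Z : Type*} [TopologicalSpace Y] [TopologicalSpace Z]
    {F : Y → EReal} (hF : LowerSemicontinuous F) {g : Z → Y} (hg : Continuous g) {a : Z → ℝ}
    (ha : Continuous a) : IsClosed {z | F (g z) ≤ a z} :=
  hF.isClosed_epigraph.preimage (hg.prodMk (continuous_coe_real_ereal.comp ha))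

theorem lowerSemicontinuous_add_coe {Y : Type*} [TopologicalSpace Y] {F : Y → EReal}
    (hF : LowerSemicontinuous F) {g : Y → ℝ} (hg : Continuous g) :
    LowerSemicontinuous fun y => F y + g y :=
  hF.add' (continuous_coe_real_ereal.comp hg).lowerSemicontinuous fun _ =>
    EReal.continuousAt_add (.inr (EReal.coe_ne_bot _)) (.inr (EReal.coe_ne_top _))

theorem exists_upperBound_of_dist_le_abs_sub {Y : Type*} [PseudoMetricSpace Y] [CompleteSpace Y]
    {C c : Set (Y × ℝ)} (hC : IsClosed C) {κ B : ℝ} (hκ : 0 < κ) (hB : ∀ p ∈ C, p.2 ≤ B)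
    (hcC : c ⊆ C) (hne : c.Nonempty)
    (hchain : ∀ p ∈ c, ∀ q ∈ c, κ * dist p.1 q.1 ≤ |q.2 - p.2|) :
    ∃ b ∈ C, ∀ p ∈ c, κ * dist p.1 b.1 ≤ b.2 - p.2 := by
  have hbdd : BddAbove (Prod.snd '' c) := ⟨B, Set.forall_mem_image.2 fun p hp => hB p (hcC hp)⟩
  obtain ⟨_, -, hs, hsc⟩ := exists_seq_tendsto_sSup (hne.image Prod.snd) hbdd
  choose p hpc hps using hsc
  obtain rfl : (fun n => (p n).2) = _ := funext hps
  have hcauchy : CauchySeq fun n => (p n).1 := by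
    rw [cauchySeq_iff_tendsto_dist_atTop_0]
    have hsmall := (cauchySeq_iff_tendsto_dist_atTop_0.1 hs.cauchySeq).const_mul κ⁻¹
    rw [mul_zero] at hsmall
    refine squeeze_zero (fun _ => dist_nonneg) (fun n => ?_) hsmall
    rw [le_inv_mul_iff₀ hκ, dist_comm (p n.1).2, Real.dist_eq]
    exact hchain _ (hpc _) _ (hpc _)
  obtain ⟨y, hy⟩ := cauchySeq_tendsto_of_complete hcauchy
  refine ⟨(y, _), hC.mem_of_tendsto (hy.prodMk_nhds hs) (.of_forall fun n => hcC (hpc n)), ?_⟩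
  intro q hq
  have hle : q.2 ≤ sSup (Prod.snd '' c) := le_csSup hbdd (Set.mem_image_of_mem _ hq)
  rw [← abs_of_nonneg (sub_nonneg.2 hle)]
  exact le_of_tendsto_of_tendsto' ((tendsto_const_nhds.dist hy).const_mul κ)
    (hs.sub_const q.2).abs fun n => hchain q hq _ (hpc n)

variable {Y : Type*} [MetricSpace Y] [CompleteSpace Y]

theorem exists_phelps_maximal {C : Set (Y × ℝ)} (hC : IsClosed C) {κ B : ℝ} (hκ : 0 < κ)
    (hB : ∀ p ∈ C, p.2 ≤ B) {a : Y × ℝ} (ha : a ∈ C) :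
    ∃ b ∈ C, κ * dist a.1 b.1 ≤ b.2 - a.2 ∧
      ∀ q ∈ C, κ * dist b.1 q.1 ≤ q.2 - b.2 → q = b := by
  let R : Y × ℝ → Y × ℝ → Prop := fun p q => κ * dist p.1 q.1 ≤ q.2 - p.2
  have R_trans {p q p' : Y × ℝ} (hpq : R p q) (hqp' : R q p') : R p p' := by
    have := mul_le_mul_of_nonneg_left (dist_triangle p.1 q.1 p'.1) hκ.le
    simp only [R] at hpq hqp' ⊢
    linarith
  have R_antisymm {p q : Y × ℝ} (hpq : R p q) (hqp : R q p) : p = q := by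
    simp only [R, dist_comm q.1] at hpq hqp
    have hdist : 0 ≤ κ * dist p.1 q.1 := by positivity
    refine Prod.ext (dist_le_zero.1 (nonpos_of_mul_nonpos_right ?_ hκ)) ?_ <;> linarith
  have hsection : IsClosed {q : Y × ℝ | κ * dist a.1 q.1 ≤ q.2 - a.2} :=
    isClosed_le (by fun_prop) (by fun_prop)
  have hCa : IsClosed {q | q ∈ C ∧ R a q} := hC.inter hsection
  have hchain (c : Set {q // q ∈ C ∧ R a q})
      (hc : IsChain (fun p q : {q // q ∈ C ∧ R a q} => R p q) c) (hne : c.Nonempty) :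
      ∃ b : {q // q ∈ C ∧ R a q}, ∀ p ∈ c, R p b := by
    obtain ⟨b, hb, hcb⟩ := exists_upperBound_of_dist_le_abs_sub hCa hκ (fun p hp => hB p hp.1)
      (Subtype.coe_image_subset _ c) (hne.image _) (by
        rintro _ ⟨p, hp, rfl⟩ _ ⟨q, hq, rfl⟩
        rcases eq_or_ne p q with rfl | hpq
        · simp
        rcases hc hp hq hpq with h | h
        · exact h.trans (le_abs_self _)
        · rw [dist_comm, abs_sub_comm]
          exact h.trans (le_abs_self _))
    exact ⟨⟨b, hb⟩, fun p hp => hcb p ⟨p, hp, rfl⟩⟩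
  have : Nonempty {q // q ∈ C ∧ R a q} := ⟨a, ha, by simp [R]⟩
  obtain ⟨⟨b, hbC, hab⟩, hmax⟩ := exists_maximal_of_nonempty_chains_bounded hchain R_trans
  exact ⟨b, hbC, hab, fun q hq hbq =>
    R_antisymm (hmax ⟨q, hq, R_trans hab hbq⟩ hbq) hbq⟩

theorem exists_ekeland_point {F : Y → EReal} (hF : LowerSemicontinuous F) {C : Set Y}
    (hC : IsClosed C) {m r ε : ℝ} (hε : 0 < ε) (hm : ∀ y ∈ C, m ≤ F y) {a : Y} (ha : a ∈ C)
    (hFa : F a ≤ r) :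
    ∃ z ∈ C, ε * dist a z ≤ r - m ∧ F z ≤ r ∧ ∀ y ∈ C, F z ≤ F y + (ε * dist z y : ℝ) := by
  have hclosed : IsClosed {p : Y × ℝ | p.1 ∈ C ∧ F p.1 ≤ (-p.2 : ℝ)} :=
    (hC.preimage continuous_fst).inter
      (isClosed_setOf_apply_le hF continuous_fst continuous_snd.neg)
  have hbound (p : Y × ℝ) (hp : p ∈ {p : Y × ℝ | p.1 ∈ C ∧ F p.1 ≤ (-p.2 : ℝ)}) : p.2 ≤ -m :=
    le_neg.2 (EReal.coe_le_coe_iff.1 ((hm _ hp.1).trans hp.2))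
  obtain ⟨⟨z, s⟩, ⟨hz, hFz⟩, hd, hmax⟩ :=
    exists_phelps_maximal hclosed hε hbound (a := (a, -r)) ⟨ha, by simpa using hFa⟩
  have hsm := hbound (z, s) ⟨hz, hFz⟩
  have hdist : 0 ≤ ε * dist a z := by positivity
  simp only [sub_neg_eq_add] at hz hFz hd hsm
  refine ⟨z, hz, by linarith, hFz.trans (EReal.coe_le_coe_iff.2 (by linarith)), fun y hy => ?_⟩
  by_contra! hlt
  have hFy : F y ≤ (-(s + ε * dist z y) : ℝ) := by
    rw [neg_add', EReal.coe_sub, EReal.le_sub_iff_add_le (by simp) (by simp)]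
    exact hlt.le.trans hFz
  obtain rfl : y = z := congrArg Prod.fst (hmax (y, s + ε * dist z y) ⟨hy, hFy⟩ (by simp))
  simp at hlt

end VariationalPrinciple

section DirectionalLimsup

theorem limsup_inf_principal_le_limsup {Y β : Type*} [TopologicalSpace Y] [CompleteLattice β]
    {l : Filter Y} (hl : ∀ p : Y → Prop, (∀ᶠ y in l, p y) → ∀ᶠ y in l, ∀ᶠ z in 𝓝 y, p z)
    {s : Set Y} {F G : Y → β} (hFG : ∀ y ∈ s, F y ≤ limsup G (𝓝[s] y)) :
    limsup F (l ⊓ 𝓟 s) ≤ limsup G (l ⊓ 𝓟 s) := by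
  refine le_sInf fun a ha => limsup_le_of_le (h := ?_)
  have hGa : ∀ᶠ y in l, y ∈ s → G y ≤ a := eventually_inf_principal.1 ha
  rw [eventually_inf_principal]
  filter_upwards [hl _ hGa] with y hy hys
  exact (hFG y hys).trans (limsup_le_of_le (h := eventually_nhdsWithin_iff.2 hy))

variable {X : Type u} [NormedAddCommGroup X] [NormedSpace ℝ X]

theorem eventually_eventually_nhds_of_dirNhds {x v : X} {p : X → Prop}
    (h : ∀ᶠ y in dirNhds x v, p y) : ∀ᶠ y in dirNhds x v, ∀ᶠ z in 𝓝 y, p z := by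
  rw [dirNhds, eventually_map] at h ⊢
  obtain ⟨pt, hpt, pw, hpw, hp⟩ := eventually_prod_iff.1 h
  filter_upwards [(hpt.and self_mem_nhdsWithin).prod_mk hpw.eventually_nhds]
    with ⟨t, w⟩ ⟨⟨ht, (ht0 : 0 < t)⟩, hw⟩
  have hdir : Tendsto (fun z : X => t⁻¹ • (z - x)) (𝓝 (x + t • w)) (𝓝 w) := by
    have : Continuous fun z : X => t⁻¹ • (z - x) := by fun_prop
    simpa [smul_smul, ht0.ne'] using this.tendsto (x + t • w)
  filter_upwards [hdir.eventually hw] with z hz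
  simpa [smul_smul, ht0.ne'] using hp ht hz

theorem dirLimsup_mono {f F G : X → EReal} (x v : X) (h : ∀ y ∈ effDom f, F y ≤ G y) :
    dirLimsup f x v F ≤ dirLimsup f x v G :=
  limsup_le_limsup (eventually_inf_principal.2 (.of_forall h))

theorem dirLimsup_shift_le_of_le_limsup {f : X → EReal} {F G : X → X → EReal} {α : ℝ}
    (hFG : ∀ y ∈ effDom f, ∀ w,
      F y w ≤ limsup (fun z => G z (w + α • (y - z))) (𝓝[effDom f] y)) (x u v : X) :
    dirLimsup f x v (fun y => F y (u + α • (x - y))) ≤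
      dirLimsup f x v (fun y => G y (u + α • (x - y))) := by
  refine limsup_inf_principal_le_limsup (fun _ => eventually_eventually_nhds_of_dirNhds)
    fun y hy => (hFG y hy _).trans_eq ?_
  congr! 3 with z
  module

end DirectionalLimsup

section Subderivatives

theorem IsProperLsc.exists_eq_coe {X : Type u} [TopologicalSpace X] {f : X → EReal}
    (hf : IsProperLsc f) {x : X} (hx : x ∈ effDom f) : ∃ r : ℝ, f x = r :=
  ⟨(f x).toReal, (EReal.coe_toReal (ne_of_lt hx) (hf.ne_bot x)).symm⟩

theorem tendsto_graphNhds {X : Type u} [TopologicalSpace X] (f : X → EReal) (x : X) :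
    Tendsto (fun y => (y, f y)) (graphNhds f x) (𝓝 x ×ˢ 𝓝 (f x)) :=
  tendsto_comap.mono_right nhds_prod_eq.le

variable {X : Type u} [NormedAddCommGroup X] [NormedSpace ℝ X]

theorem diffQuot_le_iff {f : X → EReal} {x u : X} {r t l : ℝ} (hr : f x = r) (ht : 0 < t) :
    diffQuot f x t u ≤ l ↔ f (x + t • u) ≤ (r + t * l : ℝ) := by
  rw [diffQuot, hr, EReal.div_le_iff_le_mul (by exact_mod_cast ht) (EReal.coe_ne_top t),
    EReal.sub_le_iff_le_add (by simp) (by simp), ← EReal.coe_mul, ← EReal.coe_add,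
    add_comm (t * l)]

theorem directionalSubderiv_le_radialSubderiv (f : X → EReal) (x u : X) :
    directionalSubderiv f x u ≤ radialSubderiv f x u :=
  liminf_le_liminf_of_le (tendsto_id.prodMk tendsto_const_nhds)

theorem radialSubderiv_zero {f : X → EReal} {x : X} {r : ℝ} (hr : f x = r) :
    radialSubderiv f x 0 = 0 := by
  have hquot (t : ℝ) : diffQuot f x t 0 = 0 := by
    rw [diffQuot, smul_zero, add_zero, hr, ← EReal.coe_sub, sub_self, EReal.coe_zero,
      EReal.zero_div]
  simp only [radialSubderiv, hquot, liminf_const]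

theorem exists_add_smul_le_of_directionalSubderiv_lt {f : X → EReal} {x u : X} {r l : ℝ}
    (hr : f x = r) (hl : directionalSubderiv f x u < l) {V : Set X} (hV : V ∈ 𝓝 u) {ε : ℝ}
    (hε : 0 < ε) :
    ∃ t ∈ Set.Ioo 0 ε, ∃ u' ∈ V, f (x + t • u') ≤ (r + t * l : ℝ) := by
  have hfreq := frequently_lt_of_liminf_lt (h := hl)
  have hev : ∀ᶠ p : ℝ × X in 𝓝[>] 0 ×ˢ 𝓝 u, p.1 ∈ Set.Ioo 0 ε ∧ p.2 ∈ V :=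
    prod_mem_prod (Ioo_mem_nhdsGT hε) hV
  obtain ⟨⟨t, u'⟩, hquot, ht, hu'⟩ := (hfreq.and_eventually hev).exists
  exact ⟨t, ht, u', hu', (diffQuot_le_iff hr ht.1).1 hquot.le⟩

/-- Phelps' principle applies to the set of pairs `(e, s)` such that `f` has grown with slope at
most `l` at `x + s w + e`: a maximal pair with `s < t` could be prolonged by one more step. -/
theorem exists_le_of_forall_directionalSubderiv_lt [CompleteSpace X] {f : X → EReal}
    (hf : IsProperLsc f) {x w : X} {r t l δ : ℝ} (hr : f x = r) (ht : 0 ≤ t) (hδ : 0 < δ)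
    (hslope : ∀ z ∈ effDom f, dist z x ≤ (δ + ‖w‖) * t →
      ∃ w' ∈ Metric.ball w δ, directionalSubderiv f z w' < l) :
    ∃ e : X, ‖e‖ ≤ δ * t ∧ f (x + t • w + e) ≤ (r + t * l : ℝ) := by
  have hclosed : IsClosed {p : X × ℝ | p.2 ≤ t ∧ f (x + p.2 • w + p.1) ≤ (r + p.2 * l : ℝ)} :=
    (isClosed_le continuous_snd continuous_const).inter
      (isClosed_setOf_apply_le hf.lsc (by fun_prop) (by fun_prop))
  obtain ⟨⟨e, s⟩, ⟨hst, hfz⟩, hd, hmax⟩ := exists_phelps_maximal hclosed (inv_pos.2 hδ)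
    (fun p hp => hp.1) (a := (0, 0)) ⟨ht, by simp [hr]⟩
  simp only [dist_zero_left, sub_zero, inv_mul_le_iff₀ hδ] at hst hfz hd hmax
  have hs : 0 ≤ s := nonneg_of_mul_nonneg_right ((norm_nonneg e).trans hd) hδ
  rcases hst.eq_or_lt with rfl | hst
  · exact ⟨e, hd, hfz⟩
  exfalso
  obtain ⟨ρ, hρ⟩ := hf.exists_eq_coe (hfz.trans_lt (EReal.coe_lt_top _))
  have hzx : dist (x + s • w + e) x ≤ (δ + ‖w‖) * t := by
    calc dist (x + s • w + e) x = ‖e + s • w‖ := by rw [dist_eq_norm]; congr 1; abel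
      _ ≤ ‖e‖ + s * ‖w‖ := by simpa [norm_smul, abs_of_nonneg hs] using norm_add_le e (s • w)
      _ ≤ (δ + ‖w‖) * s := by linarith
      _ ≤ (δ + ‖w‖) * t := by gcongr
  obtain ⟨w', hw', hlt⟩ := hslope _ (hfz.trans_lt (EReal.coe_lt_top _)) hzx
  obtain ⟨h, ⟨h0, hht⟩, w'', hw'', hstep⟩ := exists_add_smul_le_of_directionalSubderiv_lt hρ hlt
    (Metric.isOpen_ball.mem_nhds hw') (sub_pos.2 hst)
  rw [hρ, EReal.coe_le_coe_iff] at hfz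
  have hstep' : f (x + (s + h) • w + (e + h • (w'' - w))) ≤ (r + (s + h) * l : ℝ) := by
    convert hstep.trans (EReal.coe_le_coe_iff.2 (?_ : _ ≤ r + (s + h) * l)) using 2
    · module
    · linarith
  have hdist : dist e (e + h • (w'' - w)) ≤ δ * (s + h - s) := by
    rw [dist_self_add_right, norm_smul, Real.norm_of_nonneg h0.le, add_sub_cancel_left, mul_comm]
    gcongr
    exact (mem_ball_iff_norm.1 hw'').le
  have := congrArg Prod.snd (hmax (_, s + h) ⟨by linarith, hstep'⟩ hdist)
  simp only at this
  linarith

theorem clarkeRockafellarSubderiv_le_of_eventually_lt [CompleteSpace X] {f : X → EReal}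
    (hf : IsProperLsc f) {x w : X} (hx : x ∈ effDom f) {l : ℝ} {d : X → X}
    (hd : Tendsto d (𝓝 x) (𝓝 w))
    (hl : ∀ᶠ z in 𝓝[effDom f] x, directionalSubderiv f z (d z) < l) :
    clarkeRockafellarSubderiv f x w ≤ l := by
  refine iSup₂_le fun δ hδ => limsup_le_of_le (h := ?_)
  obtain ⟨ρ, hρ, hslope⟩ := Metric.eventually_nhds_iff.1
    ((eventually_nhdsWithin_iff.1 hl).and (hd.eventually (Metric.ball_mem_nhds w hδ)))
  have hgraph : ∀ᶠ y in graphNhds f x, dist y x < ρ / 2 ∧ y ∈ effDom f :=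
    (tendsto_graphNhds f x).eventually
      (prod_mem_prod (Metric.ball_mem_nhds x (half_pos hρ)) (Iio_mem_nhds hx))
  have htime : ∀ᶠ t : ℝ in 𝓝[>] 0, 0 < t ∧ (δ + ‖w‖) * t < ρ / 2 := by
    have : Continuous fun t : ℝ => (δ + ‖w‖) * t := by fun_prop
    exact eventually_mem_nhdsWithin.and
      (nhdsWithin_le_nhds (this.continuousAt.eventually_lt_const (by simpa using hρ)))
  filter_upwards [htime.prod_mk hgraph] with ⟨t, y⟩ ⟨⟨ht, htρ⟩, hy, hyd⟩
  obtain ⟨r, hr⟩ := hf.exists_eq_coe hyd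
  obtain ⟨e, he, hle⟩ := exists_le_of_forall_directionalSubderiv_lt hf hr ht.le hδ
    fun z hz hzy => by
      have hzx : dist z x < ρ := by linarith [dist_triangle z y x]
      exact ⟨d z, (hslope hzx).2, (hslope hzx).1 hz⟩
  refine iInf₂_le_of_le (w + t⁻¹ • e) ?_ ((diffQuot_le_iff hr ht).2 ?_)
  · rwa [mem_closedBall_iff_norm, add_sub_cancel_left, norm_smul, norm_inv,
      Real.norm_of_nonneg ht.le, inv_mul_le_iff₀ ht, mul_comm]
  · rwa [smul_add, smul_inv_smul₀ ht.ne', ← add_assoc]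

theorem clarkeRockafellarSubderiv_le_limsup_directionalSubderiv [CompleteSpace X] {f : X → EReal}
    (hf : IsProperLsc f) {x : X} (hx : x ∈ effDom f) (w : X) (α : ℝ) :
    clarkeRockafellarSubderiv f x w ≤
      limsup (fun z => directionalSubderiv f z (w + α • (x - z))) (𝓝[effDom f] x) := by
  have hd : Continuous fun z => w + α • (x - z) := by fun_prop
  exact EReal.le_of_forall_lt_iff_le.1 fun l hl =>
    clarkeRockafellarSubderiv_le_of_eventually_lt hf hx (by simpa using hd.tendsto x)
      (eventually_lt_of_limsup_lt hl)

theorem supportFn_le_clarkeRockafellarSubderiv {S : Set (X →L[ℝ] ℝ)} {f : X → EReal} {x : X}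
    (hS : S ⊆ clarkeSubdiff f x) (u : X) : supportFn S u ≤ clarkeRockafellarSubderiv f x u :=
  iSup₂_le fun _ hxs => (hS hxs).2 u

theorem clarkeRockafellarSubderiv_le_of_convexOn {g : X → ℝ} (hg : ConvexOn ℝ Set.univ g)
    (hcont : Continuous g) (x u : X) :
    clarkeRockafellarSubderiv (fun y => (g y : EReal)) x u ≤ (g (x + u) - g x : ℝ) := by
  refine iSup₂_le fun δ hδ => EReal.le_of_forall_lt_iff_le.1 fun l hl =>
    limsup_le_of_le (h := ?_)
  have hnear : ∀ᶠ y in graphNhds (fun y => (g y : EReal)) x, g (y + u) - g y < l := by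
    have hc : Continuous fun y => g (y + u) - g y := by fun_prop
    exact (tendsto_fst.comp (tendsto_graphNhds _ x)).eventually
      (hc.continuousAt.eventually_lt_const (EReal.coe_lt_coe_iff.1 hl))
  have hunit : ∀ᶠ t : ℝ in 𝓝[>] 0, t ∈ Set.Ioo 0 1 := Ioo_mem_nhdsGT one_pos
  filter_upwards [hunit.prod_mk hnear] with ⟨t, y⟩ ⟨⟨ht0, ht1⟩, hy⟩
  refine iInf₂_le_of_le u (Metric.mem_closedBall_self hδ.le) ?_
  rw [diffQuot_le_iff (f := fun y => (g y : EReal)) rfl ht0, EReal.coe_le_coe_iff]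
  have hconv := hg.2 (Set.mem_univ y) (Set.mem_univ (y + u)) (sub_nonneg.2 ht1.le) ht0.le
    (sub_add_cancel 1 t)
  rw [show (1 - t) • y + t • (y + u) = y + t • u by module, smul_eq_mul, smul_eq_mul] at hconv
  dsimp only at hy ht0 ⊢
  nlinarith

theorem supportFn_controlledClosure_le_limsup {f : X → EReal} {T : X → Set (X →L[ℝ] ℝ)} {x : X}
    (hx : x ∈ effDom f) {α : ℝ} (hα : 0 ≤ α) (w : X) :
    supportFn (controlledClosure f T x) w ≤
      limsup (fun z => supportFn (T z) (w + α • (x - z))) (𝓝[effDom f] x) := by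
  refine iSup₂_le fun xs ⟨ι, _, _, _, y, ys, hys, hy, hlim, hsup⟩ =>
    EReal.ge_of_forall_gt_iff_ge.1 fun l hl => ?_
  rw [EReal.coe_lt_coe_iff] at hl
  have hyx : Tendsto y atTop (𝓝[effDom f] x) := by
    rw [nhds_prod_eq] at hy
    exact tendsto_nhdsWithin_iff.2
      ⟨tendsto_fst.comp hy, (tendsto_snd.comp hy).eventually (Iio_mem_nhds hx)⟩
  obtain ⟨κ, hκ, hακ⟩ : ∃ κ > 0, α * κ < xs w - l := exists_pos_mul_lt (sub_pos.2 hl) α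
  have hvalue : ∀ᶠ ν in atTop, l + α * κ < ys ν w :=
    (hlim w).eventually_const_lt (by linarith)
  have hcontrol : ∀ᶠ ν in atTop, ys ν (y ν - x) < κ := by
    filter_upwards [eventually_lt_of_limsup_lt (hsup.trans_lt (EReal.coe_pos.2 hκ))] with ν hν
    exact EReal.coe_lt_coe_iff.1 hν
  refine le_limsup_of_frequently_le' (hyx.frequently (Eventually.frequently ?_))
  filter_upwards [hvalue, hcontrol] with ν hν hν'
  refine le_iSup₂_of_le (ys ν) (hys ν) (EReal.coe_le_coe_iff.2 ?_)
  calc l ≤ ys ν w - α * κ := by linarith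
    _ ≤ ys ν w - α * ys ν (y ν - x) := by gcongr
    _ = ys ν (w + α • (x - y ν)) := by simp only [map_add, map_smul, map_sub, smul_eq_mul]; ring

end Subderivatives

section Penalization

theorem exists_forall_le_add_mul_infDist {Y : Type*} [PseudoMetricSpace Y] {F : Y → EReal}
    (hF : LowerSemicontinuous F) {S B : Set Y} (hS : IsCompact S) (hne : S.Nonempty) {m a : ℝ}
    (hm : ∀ y ∈ B, m ≤ F y) (ha : ∀ y ∈ S, a < F y) :
    ∃ N : ℝ, 0 ≤ N ∧ ∀ y ∈ B, a ≤ F y + (N * Metric.infDist y S : ℝ) := by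
  obtain ⟨γ, hγ, hthick⟩ := hS.exists_thickening_subset_open (hF.isOpen_preimage a) ha
  refine ⟨|a - m| / γ, by positivity, fun y hy => ?_⟩
  rcases lt_or_ge (Metric.infDist y S) γ with hyγ | hyγ
  · have hay : a < F y := hthick ((Metric.mem_thickening_iff_infDist_lt hne).2 hyγ)
    have hpen : 0 ≤ |a - m| / γ * Metric.infDist y S :=
      mul_nonneg (by positivity) Metric.infDist_nonneg
    exact hay.le.trans (le_add_of_nonneg_right (EReal.coe_nonneg.2 hpen))
  · have hpen : a ≤ m + |a - m| / γ * Metric.infDist y S := by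
      have : |a - m| ≤ |a - m| / γ * Metric.infDist y S := by
        rw [div_mul_eq_mul_div, le_div_iff₀ hγ]
        gcongr
      linarith [le_abs_self (a - m)]
    calc (a : EReal) ≤ m + (|a - m| / γ * Metric.infDist y S : ℝ) := by exact_mod_cast hpen
      _ ≤ F y + (|a - m| / γ * Metric.infDist y S : ℝ) := by gcongr; exact hm y hy

variable {X : Type u} [NormedAddCommGroup X] [NormedSpace ℝ X]

theorem convexOn_univ_infDist {S : Set X} (hS : Convex ℝ S) (hne : S.Nonempty) :
    ConvexOn ℝ Set.univ fun y => Metric.infDist y S := by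
  refine ⟨convex_univ, fun x _ y _ a b ha hb hab => le_of_forall_pos_le_add fun ε hε => ?_⟩
  obtain ⟨p, hp, hxp⟩ := (Metric.infDist_lt_iff hne).1 (lt_add_of_pos_right (Metric.infDist x S) hε)
  obtain ⟨q, hq, hyq⟩ := (Metric.infDist_lt_iff hne).1 (lt_add_of_pos_right (Metric.infDist y S) hε)
  calc Metric.infDist (a • x + b • y) S
      ≤ dist (a • x + b • y) (a • p + b • q) :=
        Metric.infDist_le_dist_of_mem (hS hp hq ha hb hab)
    _ ≤ dist (a • x) (a • p) + dist (b • y) (b • q) := dist_add_add_le _ _ _ _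
    _ = a * dist x p + b * dist y q := by
        rw [dist_smul₀, dist_smul₀, Real.norm_of_nonneg ha, Real.norm_of_nonneg hb]
    _ ≤ a * (Metric.infDist x S + ε) + b * (Metric.infDist y S + ε) := by gcongr
    _ = a * Metric.infDist x S + b * Metric.infDist y S + (a + b) * ε := by ring
    _ = a • Metric.infDist x S + b • Metric.infDist y S + ε := by
        rw [hab, one_mul, smul_eq_mul, smul_eq_mul]

theorem segment_add_smul_eq_image (x w : X) {t : ℝ} (ht : 0 ≤ t) :
    segment ℝ x (x + t • w) = (fun s : ℝ => x + s • w) '' Set.Icc 0 t := by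
  have hIcc : Set.Icc 0 t = (fun θ : ℝ => θ * t) '' Set.Icc 0 1 := by
    rw [Set.image_mul_right_Icc zero_le_one ht, zero_mul, one_mul]
  simp only [segment_eq_image', hIcc, Set.image_image, add_sub_cancel_left, smul_smul]

theorem isCompact_segment (x y : X) : IsCompact (segment ℝ x y) := by
  rw [segment_eq_image']
  exact isCompact_Icc.image (by fun_prop)

theorem eventually_exists_infDist_segment_eq (x w : X) {t : ℝ} (ht : 0 < t) :
    ∀ᶠ z in 𝓝 x, ∃ s ∈ Set.Ico 0 t,
      Metric.infDist z (segment ℝ x (x + t • w)) = dist z (x + s • w) := by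
  have hclose : ∀ᶠ z in 𝓝 x, w ≠ 0 → 2 * dist z x < t * ‖w‖ := by
    rcases eq_or_ne w 0 with hw | hw
    · exact .of_forall fun _ h => (h hw).elim
    · have hc : Continuous fun z => 2 * dist z x := by fun_prop
      have : 0 < t * ‖w‖ := mul_pos ht (norm_pos_iff.2 hw)
      filter_upwards [hc.continuousAt.eventually_lt_const (by simpa using this)] with z hz _
      exact hz
  filter_upwards [hclose] with z hz
  have hxS := left_mem_segment ℝ x (x + t • w)
  obtain ⟨p, hp, hzp⟩ := (isCompact_segment x (x + t • w)).exists_infDist_eq_dist ⟨x, hxS⟩ z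
  rw [segment_add_smul_eq_image x w ht.le] at hp
  obtain ⟨s, ⟨hs, -⟩, rfl⟩ := hp
  rcases eq_or_ne w 0 with rfl | hw
  · exact ⟨0, ⟨le_rfl, ht⟩, by simp⟩
  refine ⟨s, ⟨hs, lt_of_mul_lt_mul_right (a := ‖w‖) ?_ (norm_nonneg w)⟩, hzp⟩
  calc s * ‖w‖ = dist (x + s • w) x := by simp [norm_smul, abs_of_nonneg hs]
    _ ≤ dist z (x + s • w) + dist z x := dist_triangle_left _ _ _
    _ ≤ dist z x + dist z x := by
        gcongr
        exact hzp ▸ Metric.infDist_le_dist_of_mem hxS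
    _ = 2 * dist z x := (two_mul _).symm
    _ < t * ‖w‖ := hz hw

/-- The step moves the nearest point `x + s w` of the segment to `x + ((1 - α τ) s + τ) w`, and
multiplies the distance between the two points by `1 - α τ`. -/
theorem eventually_exists_infDist_segment_step_le (x w : X) {t α : ℝ} (ht : 0 < t) (hα : 0 ≤ α) :
    ∀ᶠ z in 𝓝 x, ∃ τ : ℝ, 0 < τ ∧
      Metric.infDist (z + τ • (w + α • (x - z))) (segment ℝ x (x + t • w)) ≤
        Metric.infDist z (segment ℝ x (x + t • w)) := by
  filter_upwards [eventually_exists_infDist_segment_eq x w ht] with z ⟨s, ⟨hs, hst⟩, hzs⟩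
  obtain ⟨τ, hτα, hτs, hτ⟩ : ∃ τ : ℝ, α * τ < 1 ∧ 1 * τ < t - s ∧ 0 < τ := by
    obtain ⟨τ₁, hτ₁, hτ₁α⟩ := exists_pos_mul_lt one_pos α
    refine ⟨min τ₁ ((t - s) / 2), ?_, ?_, lt_min hτ₁ (by linarith)⟩
    · exact (mul_le_mul_of_nonneg_left (min_le_left _ _) hα).trans_lt hτ₁α
    · linarith [min_le_right τ₁ ((t - s) / 2)]
  have hτα0 : 0 ≤ α * τ := by positivity
  have hmem : x + ((1 - α * τ) * s + τ) • w ∈ segment ℝ x (x + t • w) := by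
    rw [segment_add_smul_eq_image x w ht.le]
    have : 0 ≤ (1 - α * τ) * s := mul_nonneg (by linarith) hs
    exact ⟨_, ⟨by linarith, by nlinarith⟩, rfl⟩
  refine ⟨τ, hτ, ?_⟩
  calc Metric.infDist (z + τ • (w + α • (x - z))) (segment ℝ x (x + t • w))
      ≤ dist (z + τ • (w + α • (x - z))) (x + ((1 - α * τ) * s + τ) • w) :=
        Metric.infDist_le_dist_of_mem hmem
    _ = ‖(1 - α * τ) • (z - (x + s • w))‖ := by rw [dist_eq_norm]; congr 1; module
    _ = (1 - α * τ) * dist z (x + s • w) := by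
        rw [norm_smul, Real.norm_of_nonneg (by linarith), dist_eq_norm]
    _ ≤ dist z (x + s • w) := mul_le_of_le_one_left dist_nonneg (by linarith)
    _ = Metric.infDist z (segment ℝ x (x + t • w)) := hzs.symm

theorem exists_affine_minorant_of_lt_radialSubderiv {f : X → EReal} {x w : X} {r l : ℝ}
    (hr : f x = r) (hl : l < radialSubderiv f x w) :
    ∃ c : X →L[ℝ] ℝ, l < c w ∧ ∃ t : ℝ, 0 < t ∧ ∀ y ∈ segment ℝ x (x + t • w),
      (r + c (y - x) : ℝ) ≤ f y := by
  rcases eq_or_ne w 0 with rfl | hw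
  · rw [radialSubderiv_zero hr] at hl
    refine ⟨0, by exact_mod_cast hl, 1, one_pos, fun y hy => ?_⟩
    obtain rfl : y = x := by simpa using hy
    simp [hr]
  obtain ⟨l', hll', hl'⟩ := EReal.lt_iff_exists_real_btwn.1 hl
  obtain ⟨c, hc⟩ := SeparatingDual.exists_eq_one (R := ℝ) hw
  have hslope : ∀ᶠ s : ℝ in 𝓝[>] 0, (r + s * l' : ℝ) ≤ f (x + s • w) := by
    filter_upwards [eventually_lt_of_lt_liminf hl', self_mem_nhdsWithin] with s hs hs0
    exact (not_le.1 fun h => hs.not_ge ((diffQuot_le_iff hr hs0).2 h)).le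
  obtain ⟨t, ht : 0 < t, hsub⟩ := mem_nhdsGT_iff_exists_Ioc_subset.1 hslope
  refine ⟨l' • c, by simpa [hc] using hll', t, ht, fun y hy => ?_⟩
  rw [segment_add_smul_eq_image x w ht.le] at hy
  obtain ⟨s, ⟨hs0, hst⟩, rfl⟩ := hy
  rcases hs0.eq_or_lt with rfl | hs0
  · simp [hr]
  · simpa [hc, mul_comm l'] using hsub ⟨hs0, hst⟩

end Penalization

section Separation

variable {X : Type u} [NormedAddCommGroup X] [NormedSpace ℝ X]
  {D : (X → EReal) → X → Set (X →L[ℝ] ℝ)}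

theorem exists_mem_controlledClosure_of_isLocalMin
    (hclarke : ∀ f, IsProperLsc f → ∀ x, D f x ⊆ clarkeSubdiff f x) (hsep : SeparationPrinciple D)
    {f : X → EReal} (hf : IsProperLsc f) {φ : X → ℝ} (hφ : ConvexOn ℝ Set.univ φ)
    (hφc : Continuous φ) {z : X} (hz : z ∈ effDom f) (hmin : IsLocalMin (fun y => f y + φ y) z) :
    ∃ zs ∈ controlledClosure f (D f) z, ∀ h, -zs h ≤ φ (z + h) - φ z := by
  have hproper : IsProperLsc fun y => (φ y : EReal) :=
    ⟨fun y => EReal.coe_ne_bot _, ⟨z, EReal.coe_lt_top _⟩,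
      (continuous_coe_real_ereal.comp hφc).lowerSemicontinuous⟩
  have hconvex : IsConvexFn fun y => (φ y : EReal) := by
    simpa [IsConvexFn] using hφ.convex_epigraph
  have hlip : IsLipschitzNear (fun y => (φ y : EReal)) z := by
    have hloc : LocallyLipschitz φ := by
      simpa using (hφ.locallyLipschitzOn_iff_continuousOn isOpen_univ).2 hφc.continuousOn
    obtain ⟨K, U, hU, hK⟩ := hloc z
    exact ⟨K, U, hU, φ, fun _ _ => rfl, hK⟩
  obtain ⟨zs, hzs, ys, hys, hsum⟩ := hsep f _ z hf hproper hconvex hz hlip hmin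
  refine ⟨zs, hzs, fun h => ?_⟩
  have hyh : ys h ≤ φ (z + h) - φ z := EReal.coe_le_coe_iff.1 <|
    ((hclarke _ hproper z hys).2 h).trans (clarkeRockafellarSubderiv_le_of_convexOn hφ hφc z h)
  rwa [eq_neg_of_add_eq_zero_left hsum, neg_apply, neg_neg]

/-- Ekeland's principle replaces `x` by a local minimizer `z` of `f + g + η dist(·, z)`. -/
theorem exists_mem_controlledClosure_of_approx_min [CompleteSpace X]
    (hclarke : ∀ f, IsProperLsc f → ∀ x, D f x ⊆ clarkeSubdiff f x) (hsep : SeparationPrinciple D)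
    {f : X → EReal} (hf : IsProperLsc f) {g : X → ℝ} (hg : ConvexOn ℝ Set.univ g)
    (hgc : Continuous g) {x : X} {r ε η ρ : ℝ} (hr : f x = r) (hη : 0 < η) (hρ : 0 ≤ ρ)
    (hε : ε < η * ρ)
    (hmin : ∀ y ∈ Metric.closedBall x ρ, (r + g x - ε : ℝ) ≤ f y + g y) :
    ∃ z ∈ Metric.ball x ρ, z ∈ effDom f ∧ ∃ zs ∈ controlledClosure f (D f) z,
      ∀ h, -zs h ≤ g (z + h) - g z + η * ‖h‖ := by
  obtain ⟨z, -, hxz, hFz, hek⟩ := exists_ekeland_point (lowerSemicontinuous_add_coe hf.lsc hgc)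
    Metric.isClosed_closedBall hη hmin (Metric.mem_closedBall_self hρ)
    (r := r + g x) (by rw [hr, EReal.coe_add])
  have hzρ : z ∈ Metric.ball x ρ := by
    rw [Metric.mem_ball, dist_comm]
    exact lt_of_mul_lt_mul_left (by linarith) hη.le
  have hz : z ∈ effDom f := by
    refine lt_top_iff_ne_top.2 fun htop : f z = ⊤ => ?_
    rw [htop, EReal.top_add_coe, top_le_iff] at hFz
    exact EReal.coe_ne_top _ hFz
  have hloc : IsLocalMin (fun y => f y + (g y + η * dist y z : ℝ)) z := by
    filter_upwards [Metric.isOpen_ball.mem_nhds hzρ] with y hy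
    simpa [add_assoc, dist_comm] using hek y (Metric.ball_subset_closedBall hy)
  obtain ⟨zs, hzs, hsub⟩ := exists_mem_controlledClosure_of_isLocalMin hclarke hsep hf
    (hg.add ((convexOn_univ_dist z).smul hη.le)) (by fun_prop) hz hloc
  refine ⟨z, hzρ, hz, zs, hzs, fun h => (hsub h).trans_eq ?_⟩
  simp only [Pi.add_apply, smul_eq_mul, dist_self, dist_self_add_left]
  ring

theorem exists_mem_controlledClosure_of_approx_min_on_isCompact [CompleteSpace X]
    (hclarke : ∀ f, IsProperLsc f → ∀ x, D f x ⊆ clarkeSubdiff f x) (hsep : SeparationPrinciple D)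
    {f : X → EReal} (hf : IsProperLsc f) {g : X → ℝ} (hg : ConvexOn ℝ Set.univ g)
    (hgc : Continuous g) {S : Set X} (hS : IsCompact S) (hSc : Convex ℝ S) {x : X} (hx : x ∈ S)
    {r m ε η ρ : ℝ} (hr : f x = r) (hη : 0 < η) (hρ : 0 ≤ ρ) (hε : ε < η * ρ)
    (hm : ∀ y ∈ Metric.closedBall x ρ, m ≤ f y + g y)
    (hmin : ∀ y ∈ S, (r + g x - ε : ℝ) < f y + g y) :
    ∃ z ∈ Metric.ball x ρ, z ∈ effDom f ∧ ∃ zs ∈ controlledClosure f (D f) z,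
      ∀ h, Metric.infDist (z + h) S ≤ Metric.infDist z S → -zs h ≤ g (z + h) - g z + η * ‖h‖ := by
  obtain ⟨N, hN, hpen⟩ :=
    exists_forall_le_add_mul_infDist (lowerSemicontinuous_add_coe hf.lsc hgc) hS ⟨x, hx⟩ hm hmin
  have hpen' : ∀ y ∈ Metric.closedBall x ρ,
      (r + (g x + N * Metric.infDist x S) - ε : ℝ) ≤ f y + (g y + N * Metric.infDist y S : ℝ) := by
    intro y hy
    rw [Metric.infDist_zero_of_mem hx, mul_zero, add_zero, EReal.coe_add (g y), ← add_assoc]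
    exact hpen y hy
  obtain ⟨z, hzρ, hz, zs, hzs, hsub⟩ := exists_mem_controlledClosure_of_approx_min hclarke hsep hf
    (hg.add ((convexOn_univ_infDist hSc ⟨x, hx⟩).smul hN)) (by fun_prop) hr hη hρ hε hpen'
  refine ⟨z, hzρ, hz, zs, hzs, fun h hstep => (hsub h).trans ?_⟩
  have := mul_le_mul_of_nonneg_left hstep hN
  simp only [Pi.add_apply, smul_eq_mul]
  linarith

theorem exists_mem_controlledClosure_of_lt_radialSubderiv [CompleteSpace X]
    (hclarke : ∀ f, IsProperLsc f → ∀ x, D f x ⊆ clarkeSubdiff f x) (hsep : SeparationPrinciple D)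
    {f : X → EReal} (hf : IsProperLsc f) {x w : X} (hx : x ∈ effDom f) {α : ℝ} (hα : 0 ≤ α)
    {l : ℝ} (hl : l < radialSubderiv f x w) {U : Set X} (hU : U ∈ 𝓝 x) :
    ∃ z ∈ U, z ∈ effDom f ∧ ∃ zs ∈ controlledClosure f (D f) z, l < zs (w + α • (x - z)) := by
  obtain ⟨r, hr⟩ := hf.exists_eq_coe hx
  obtain ⟨c, hlc, t, ht, hc⟩ := exists_affine_minorant_of_lt_radialSubderiv hr hl
  obtain ⟨η, hη, hηw⟩ := exists_pos_mul_lt (sub_pos.2 hlc) ‖w‖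
  have hbelow : ∀ᶠ y in 𝓝 x, ((r - c x - 1 : ℝ) : EReal) < f y + (-c y : ℝ) := by
    have hFx : ((r - c x - 1 : ℝ) : EReal) < f x + (-c x : ℝ) := by
      rw [hr]
      exact_mod_cast (by linarith : r - c x - 1 < r + -c x)
    exact lowerSemicontinuous_add_coe hf.lsc (by fun_prop) x _ hFx
  have hslope : ∀ᶠ z in 𝓝 x, l < c (w + α • (x - z)) - η * ‖w + α • (x - z)‖ := by
    have : Continuous fun z => c (w + α • (x - z)) - η * ‖w + α • (x - z)‖ := by fun_prop
    refine this.continuousAt.eventually_const_lt ?_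
    simp only [sub_self, smul_zero, add_zero]
    linarith
  obtain ⟨ρ, hρ, hnear⟩ := Metric.nhds_basis_closedBall.eventually_iff.1 ((hbelow.and hU).and
    (hslope.and (eventually_exists_infDist_segment_step_le x w ht hα)))
  have hερ : 0 < η * ρ := by positivity
  have hmin (y) (hy : y ∈ segment ℝ x (x + t • w)) :
      (r + -c x - η * ρ / 2 : ℝ) < f y + (-c y : ℝ) := by
    calc ((r + -c x - η * ρ / 2 : ℝ) : EReal) < (r + c (y - x) + -c y : ℝ) := by
          rw [EReal.coe_lt_coe_iff, map_sub]
          linarith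
      _ ≤ f y + (-c y : ℝ) := by rw [EReal.coe_add]; gcongr; exact hc y hy
  obtain ⟨z, hzρ, hz, zs, hzs, hsub⟩ := exists_mem_controlledClosure_of_approx_min_on_isCompact
    hclarke hsep hf (c.toLinearMap.concaveOn convex_univ).neg (by fun_prop)
    (isCompact_segment x (x + t • w)) (convex_segment _ _) (left_mem_segment ℝ _ _) hr hη hρ.le
    (half_lt_self hερ) (fun y hy => (hnear hy).1.1.le) hmin
  obtain ⟨⟨-, hzU⟩, hlz, τ, hτ, hstep⟩ := hnear (Metric.ball_subset_closedBall hzρ)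
  refine ⟨z, hzU, hz, zs, hzs, hlz.trans_le (le_of_mul_le_mul_left ?_ hτ)⟩
  have := hsub _ hstep
  simp only [Pi.neg_apply, ContinuousLinearMap.coe_coe, map_add c z, map_smul, smul_eq_mul,
    norm_smul, Real.norm_of_nonneg hτ.le] at this
  linarith

theorem radialSubderiv_le_limsup_supportFn_controlledClosure [CompleteSpace X]
    (hclarke : ∀ f, IsProperLsc f → ∀ x, D f x ⊆ clarkeSubdiff f x) (hsep : SeparationPrinciple D)
    {f : X → EReal} (hf : IsProperLsc f) {x : X} (hx : x ∈ effDom f) {α : ℝ} (hα : 0 ≤ α)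
    (w : X) :
    radialSubderiv f x w ≤
      limsup (fun z => supportFn (controlledClosure f (D f) z) (w + α • (x - z)))
        (𝓝[effDom f] x) := by
  refine EReal.ge_of_forall_gt_iff_ge.1 fun l hl => le_limsup_of_frequently_le' ?_
  rw [frequently_nhdsWithin_iff, frequently_iff]
  intro U hU
  obtain ⟨z, hzU, hz, zs, hzs, hlt⟩ :=
    exists_mem_controlledClosure_of_lt_radialSubderiv hclarke hsep hf hx hα hl hU
  exact ⟨z, hzU, le_iSup₂_of_le zs hzs (EReal.coe_le_coe_iff.2 hlt.le), hz⟩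

end Separation

theorem theorem4p1_general {X : Type u} [NormedAddCommGroup X] [NormedSpace ℝ X]
    [CompleteSpace X] (D : (X → EReal) → X → Set (X →L[ℝ] ℝ))
    (hclarke : ∀ f, IsProperLsc f → ∀ x, D f x ⊆ clarkeSubdiff f x) (hsep : SeparationPrinciple D)
    (f : X → EReal) (hf : IsProperLsc f) (f' : X → X → EReal)
    (hf' : ∀ x ∈ effDom f, ∀ w : X,
      directionalSubderiv f x w ≤ f' x w ∧ f' x w ≤ clarkeRockafellarSubderiv f x w)
    (x₀ u v : X) (α : ℝ) (hα : 0 ≤ α) :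
    dirLimsup f x₀ v (fun x => radialSubderiv f x (u + α • (x₀ - x))) =
        dirLimsup f x₀ v (fun x => f' x (u + α • (x₀ - x))) ∧
      dirLimsup f x₀ v (fun x => f' x (u + α • (x₀ - x))) =
        dirLimsup f x₀ v (fun x => supportFn (D f x) (u + α • (x₀ - x))) := by
  let L (F : X → X → EReal) : EReal := dirLimsup f x₀ v fun x => F x (u + α • (x₀ - x))
  have mono {F G : X → X → EReal} (h : ∀ x ∈ effDom f, ∀ w, F x w ≤ G x w) : L F ≤ L G :=
    dirLimsup_mono x₀ v fun x hx => h x hx _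
  have shift {F G : X → X → EReal} (h : ∀ x ∈ effDom f, ∀ w,
      F x w ≤ limsup (fun z => G z (w + α • (x - z))) (𝓝[effDom f] x)) : L F ≤ L G :=
    dirLimsup_shift_le_of_le_limsup h x₀ u v
  have radial_le : L (radialSubderiv f) ≤ L fun x => supportFn (controlledClosure f (D f) x) :=
    shift fun _ hx =>
      radialSubderiv_le_limsup_supportFn_controlledClosure hclarke hsep hf hx hα
  have closure_le : L (fun x => supportFn (controlledClosure f (D f) x)) ≤
      L fun x => supportFn (D f x) :=
    shift fun _ hx => supportFn_controlledClosure_le_limsup hx hα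
  have support_le : L (fun x => supportFn (D f x)) ≤ L (clarkeRockafellarSubderiv f) :=
    mono fun x _ => supportFn_le_clarkeRockafellarSubderiv (hclarke f hf x)
  have clarke_le : L (clarkeRockafellarSubderiv f) ≤ L (directionalSubderiv f) :=
    shift fun _ hx w => clarkeRockafellarSubderiv_le_limsup_directionalSubderiv hf hx w α
  have directional_le : L (directionalSubderiv f) ≤ L (radialSubderiv f) :=
    mono fun x _ => directionalSubderiv_le_radialSubderiv f x
  have le_f' : L (directionalSubderiv f) ≤ L f' := mono fun x hx w => (hf' x hx w).1
  have f'_le : L f' ≤ L (clarkeRockafellarSubderiv f) := mono fun x hx w => (hf' x hx w).2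
  constructor <;> order

theorem theorem4p1 {X : Type u} [NormedAddCommGroup X] [NormedSpace ℝ X] [CompleteSpace X]
    (D : (X → EReal) → X → Set (X →L[ℝ] ℝ)) (hD : IsSubdifferential D)
    (f : X → EReal) (hf : IsProperLsc f)
    (f' : X → X → EReal)
    (hf' : ∀ x ∈ effDom f, ∀ w : X,
      directionalSubderiv f x w ≤ f' x w ∧ f' x w ≤ clarkeRockafellarSubderiv f x w)
    (x₀ : X) (hx₀ : x₀ ∈ effDom f) (u v : X) (α : ℝ) (hα : 0 ≤ α) :
    dirLimsup f x₀ v (fun x => radialSubderiv f x (u + α • (x₀ - x))) =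
        dirLimsup f x₀ v (fun x => f' x (u + α • (x₀ - x))) ∧
      dirLimsup f x₀ v (fun x => f' x (u + α • (x₀ - x))) =
        dirLimsup f x₀ v (fun x => supportFn (D f x) (u + α • (x₀ - x))) :=
  theorem4p1_general D hD.subset_clarke hD.separation f hf f' hf' x₀ u v α hα
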